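/- Let $\nu\in\mathbb N$ and let $\omega\in\mathbb R^\nu$ be diophantine: there are $\gamma,\tau>0$ with $|k\cdot\omega|\ge\gamma|k|^{-\tau}$ for all $k\in\mathbb Z^\nu\setminus\{0\}$, where $|k|=\sum_j|k_j|$. Let $f(q)=\sum_k f_k e^{ik\cdot q}$ (a finite sum over $k\in\mathbb Z^\nu$) be a real-valued trigonometric polynomial on $\mathbb T^\nu=(\mathbb R/2\pi\mathbb Z)^\nu$, and on $\mathbb R^\nu\times\mathbb T^\nu$ let $$H_\varepsilon(p,q)=\omega\cdot p+\tfrac12 p^2+\varepsilon f(q),\qquad p^2=\sum_j p_j^2.$$ Let $\mathcal A_\varepsilon$ be the algebra of formal power series $\sum_{s\ge0}\varepsilon^sF_s(p,q)$ whose coefficients $F_s$ are trigonometric polynomials in $q$ with coefficients polynomial in $p$; a series is called real if all its $F_s$ are real-valued. Then there are real $P_j,Q_j\in\varepsilon\mathcal A_\varepsilon$ ($1\le j\le\nu$) such that the formal transformation $$q=q'+Q(p',q',\varepsilon)=q'+\varepsilon\cdots,\qquad p=p'+P(p',q',\varepsilon)=p'+\varepsilon\cdots$$ is canonical (its Jacobian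 matrix over $\mathcal A_\varepsilon$ is symplectic) and brings $H_\varepsilon$ into Kolmogorov normal form, up to an additive constant: there are $c(\varepsilon)\in\mathbb R[[\varepsilon]]$ and a real $R\in\mathcal A_\varepsilon$ with $$H_\varepsilon(p,q)=c(\varepsilon)+\omega\cdot p'+R(p',q',\varepsilon),\qquad R=O(p'^2),$$ as an identity in $\mathcal A_\varepsilon$ after formal substitution of $p,q$. Here $R=O(p'^2)$ means that at each order in $\varepsilon$ every monomial of $R$ has degree at least $2$ in $p'$. -/

import Mathlib

namespace FormalKolmogorov

/-- Functions of `(p, q)` that are trigonometric polynomials in `q`, with coefficients polynomial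
in `p`: finite sums `∑ c_{α,k} p^α e^{i k·q}`, with `α ∈ ℕ^ν`, `k ∈ ℤ^ν`, `c_{α,k} ∈ ℂ`,
seen as functions of `p ∈ ℝ^ν` and `q ∈ (ℝ/2πℤ)^ν`.
The monomial `p^α e^{i k·q}` is `single (α, k) 1`; products of monomials add exponents. -/
abbrev Obs (ν : ℕ) : Type := AddMonoidAlgebra ℂ ((Fin ν → ℕ) × (Fin ν → ℤ))

/-- Formal power series `∑_{s ≥ 0} ε^s F_s(p, q)`; the variable `PowerSeries.X` is `ε`. -/
abbrev FObs (ν : ℕ) : Type := PowerSeries (Obs ν)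

/-- The coordinate function `p_j`. -/
noncomputable def pVar {ν : ℕ} (j : Fin ν) : Obs ν :=
  AddMonoidAlgebra.single (Pi.single j 1, 0) 1

/-- The exponential `e^{i k·q}`. -/
noncomputable def expq {ν : ℕ} (k : Fin ν → ℤ) : Obs ν := AddMonoidAlgebra.single (0, k) 1

/-- `∂F/∂p_j`, that is `p^α e^{i k·q} ↦ α_j p^{α - e_j} e^{i k·q}` (which is `0` if `α_j = 0`). -/
noncomputable def dp {ν : ℕ} (j : Fin ν) (F : Obs ν) : Obs ν :=
  F.coeff.sum fun m c => AddMonoidAlgebra.single (m.1 - Pi.single j 1, m.2) ((m.1 j : ℂ) * c)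

/-- `∂F/∂q_j`, that is `p^α e^{i k·q} ↦ i k_j p^α e^{i k·q}`. -/
noncomputable def dq {ν : ℕ} (j : Fin ν) (F : Obs ν) : Obs ν :=
  F.coeff.sum fun m c => AddMonoidAlgebra.single m (Complex.I * (m.2 j : ℂ) * c)

/-- `∂/∂p_j` on series in `ε`, order by order. -/
noncomputable def Dp {ν : ℕ} (j : Fin ν) (F : FObs ν) : FObs ν :=
  PowerSeries.mk fun s => dp j (PowerSeries.coeff s F)

/-- `∂/∂q_j` on series in `ε`, order by order. -/
noncomputable def Dq {ν : ℕ} (j : Fin ν) (F : FObs ν) : FObs ν :=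
  PowerSeries.mk fun s => dq j (PowerSeries.coeff s F)

/-- `F` does not depend on `p`, i.e. it is a trigonometric polynomial `∑ c_k e^{i k·q}`. -/
def Obs.IsTrigPoly {ν : ℕ} (F : Obs ν) : Prop :=
  ∀ (α : Fin ν → ℕ) (k : Fin ν → ℤ), α ≠ 0 → F.coeff (α, k) = 0

/-- `F` takes real values for real `(p, q)`: in coefficients, `c_{α,-k}` is the complex conjugate
of `c_{α,k}`. -/
def Obs.IsReal {ν : ℕ} (F : Obs ν) : Prop :=
  ∀ (α : Fin ν → ℕ) (k : Fin ν → ℤ), F.coeff (α, -k) = star (F.coeff (α, k))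

/-- Every coefficient of the series in `ε` is real-valued. -/
def FObs.IsReal {ν : ℕ} (F : FObs ν) : Prop := ∀ s, Obs.IsReal (PowerSeries.coeff s F)

/-- `F = O(p²)`: at every order in `ε` only monomials `p^α e^{i k·q}` with `|α| ≥ 2` occur. -/
def FObs.IsOSq {ν : ℕ} (F : FObs ν) : Prop :=
  ∀ (s : ℕ) (α : Fin ν → ℕ) (k : Fin ν → ℤ), ∑ j, α j < 2 → (PowerSeries.coeff s F).coeff (α, k) = 0

/-- The exponential `∑_m g^m / m!` of a series `g` in `ε` without constant term. As `g^m` only has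
orders `≥ m`, the coefficient of `ε^n` is the finite sum over `m ≤ n`. -/
noncomputable def expSeries {ν : ℕ} (g : FObs ν) : FObs ν :=
  PowerSeries.mk fun n =>
    ∑ m ∈ Finset.range (n + 1), ((m.factorial : ℂ)⁻¹) • PowerSeries.coeff n (g ^ m)

/-- A formal change of variables `q = q' + Q(p', q', ε)`, `p = p' + P(p', q', ε)`, tangent to the
identity: `Q = ε ⋯` and `P = ε ⋯` are real series without constant term in `ε`. -/
structure FormalTransformation (ν : ℕ) where
  Q : Fin ν → FObs ν
  P : Fin ν → FObs ν
  Q_zero : ∀ j, PowerSeries.coeff 0 (Q j) = 0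
  P_zero : ∀ j, PowerSeries.coeff 0 (P j) = 0
  Q_real : ∀ j, (Q j).IsReal
  P_real : ∀ j, (P j).IsReal

namespace FormalTransformation

variable {ν : ℕ}

/-- Substitution of `p = p' + P`, `q = q' + Q` in a function without `ε`:
`p^α e^{i k·q} ↦ ∏_j (p'_j + P_j)^{α_j} · e^{i k·q'} · exp (i k·Q)`. -/
noncomputable def subst (Φ : FormalTransformation ν) (F : Obs ν) : FObs ν :=
  F.coeff.sum fun m c =>
    PowerSeries.C (AddMonoidAlgebra.single 0 c : Obs ν) *
      (∏ j, (PowerSeries.C (pVar j) + Φ.P j) ^ m.1 j) *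
      PowerSeries.C (expq m.2) * expSeries (∑ j, (Complex.I * (m.2 j : ℂ)) • Φ.Q j)

/-- The transformed series `F(p' + P, q' + Q, ε) = ∑_s ε^s F_s(p' + P, q' + Q)`. -/
noncomputable def pullback (Φ : FormalTransformation ν) (F : FObs ν) : FObs ν :=
  PowerSeries.mk fun n =>
    ∑ st ∈ Finset.HasAntidiagonal.antidiagonal n, PowerSeries.coeff st.2 (Φ.subst (PowerSeries.coeff st.1 F))

/-- The Jacobian matrix of `(q', p') ↦ (q, p) = (q' + Q, p' + P)`. -/
noncomputable def jacobian (Φ : FormalTransformation ν) :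
    Matrix (Fin ν ⊕ Fin ν) (Fin ν ⊕ Fin ν) (FObs ν) :=
  Matrix.fromBlocks
    (1 + Matrix.of fun i j => Dq j (Φ.Q i)) (Matrix.of fun i j => Dp j (Φ.Q i))
    (Matrix.of fun i j => Dq j (Φ.P i)) (1 + Matrix.of fun i j => Dp j (Φ.P i))

/-- Canonical: the Jacobian is symplectic, i.e. the canonical bracket relations
`{q_i, q_j} = {p_i, p_j} = 0`, `{q_i, p_j} = δ_ij` hold in the new variables. -/
def IsCanonical (Φ : FormalTransformation ν) : Prop :=
  Φ.jacobian ∈ Matrix.symplecticGroup (Fin ν) (FObs ν)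

end FormalTransformation

/-- `|k·ω| ≥ γ / |k|^τ` for all nonzero `k ∈ ℤ^ν`, for some `γ, τ > 0`, where `|k| = ∑ |k_j|`. -/
def Diophantine {ν : ℕ} (ω : Fin ν → ℝ) : Prop :=
  ∃ γ τ : ℝ, 0 < γ ∧ 0 < τ ∧ ∀ k : Fin ν → ℤ, k ≠ 0 →
    γ / (∑ j, |(k j : ℝ)|) ^ τ ≤ |∑ j, (k j : ℝ) * ω j|

/-- The function `ω · p`. -/
noncomputable def omegaDot {ν : ℕ} (ω : Fin ν → ℝ) : Obs ν := ∑ j, (ω j : ℂ) • pVar j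

/-- `H_ε(p, q) = ω·p + p²/2 + ε f(q)`. -/
noncomputable def hamiltonian {ν : ℕ} (ω : Fin ν → ℝ) (f : Obs ν) : FObs ν :=
  PowerSeries.C (omegaDot ω + (1 / 2 : ℂ) • ∑ j, pVar j ^ 2) + PowerSeries.X * PowerSeries.C f

/-- A series `c(ε) ∈ ℝ[[ε]]` seen as an element constant in `(p, q)`. -/
noncomputable def constSeries (ν : ℕ) (c : PowerSeries ℝ) : FObs ν :=
  PowerSeries.mk fun s => AddMonoidAlgebra.single 0 ((PowerSeries.coeff s c : ℝ) : ℂ)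

end FormalKolmogorov

/-!
The normalizing transformation is generated, with `ε` as time, by a vector field `v` depending on
`ε`: it is the inverse of the flow of `-v`, called the flow of `v` below. A function pulled back by
it is annihilated by the transport operator `δ = ∂_ε - ∑_a v_a ∂_a`, a derivation of the algebra of
formal series, and a series `F` is determined by `δF` and its coefficient of order zero
(`eq_of_transport_eq`). All identities between
series follow from this uniqueness: both sides have the same image under `δ` and agree at `ε = 0`.

* The flow is the transformation whose displacements `Q`, `P` solve `δQ_j = v_{q_j}`,
  `δP_j = v_{p_j}`. Then `δ` annihilates `p_j + P_j` and `e^{i k·q} exp (i k·Q)`, hence every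
  substituted observable (`FormalTransformation.IsFlow.transport_subst`).
* The Jacobian matrix `M` of the flow solves `δM = M B`, with `B` the Jacobian matrix of `v`. If `v`
  is Hamiltonian, then `B J + J Bᵀ = 0`, so that `δ(M J Mᵀ) = 0` and `M J Mᵀ = J`
  (`FormalTransformation.IsFlow.isCanonical`).
* The pullback `N` of `H = ω·p + p²/2 + ε f` is the solution of `δN = g`, where `g`, the pullback
  of `f`, solves `δg = 0`. The coefficient `v_n` enters that of `N` at order `n + 1` only through
  the derivative of `ω·p + p²/2` along `v_n`, which can be made to cancel any given real observable
  up to a constant and `O(p²)` because `ω` is nonresonant (`exists_field_homological`). So `v`, `N`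
  and `g` are defined by recursion on the order (`exists_field_normalizing`).
-/

namespace FormalKolmogorov

variable {ν : ℕ}

/-! ### Partial derivatives of observables -/

lemma dp_single (j : Fin ν) (m : (Fin ν → ℕ) × (Fin ν → ℤ)) (c : ℂ) :
    dp j (AddMonoidAlgebra.single m c) =
      AddMonoidAlgebra.single (m.1 - Pi.single j 1, m.2) ((m.1 j : ℂ) * c) := by
  simp [dp]

lemma dq_single (j : Fin ν) (m : (Fin ν → ℕ) × (Fin ν → ℤ)) (c : ℂ) :
    dq j (AddMonoidAlgebra.single m c) =
      AddMonoidAlgebra.single m (Complex.I * (m.2 j : ℂ) * c) := by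
  simp [dq]

lemma dp_add (j : Fin ν) (F G : Obs ν) : dp j (F + G) = dp j F + dp j G := by
  simp only [dp, AddMonoidAlgebra.coeff_add]
  exact Finsupp.sum_add_index' (by simp) (by intros; simp [mul_add])

lemma dq_add (j : Fin ν) (F G : Obs ν) : dq j (F + G) = dq j F + dq j G := by
  simp only [dq, AddMonoidAlgebra.coeff_add]
  exact Finsupp.sum_add_index' (by simp) (by intros; simp [mul_add])

lemma coeff_dp (j : Fin ν) (F : Obs ν) (α : Fin ν → ℕ) (k : Fin ν → ℤ) :
    (dp j F).coeff (α, k) = (α j + 1) * F.coeff (α + Pi.single j 1, k) := by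
  induction F using AddMonoidAlgebra.induction_linear with
  | zero => simp [dp]
  | add F G hF hG => simp [dp_add, hF, hG, mul_add]
  | single m c =>
    obtain ⟨β, l⟩ := m
    rw [dp_single]
    simp only [AddMonoidAlgebra.coeff_single, Finsupp.single_apply, Prod.mk.injEq]
    by_cases h : β = α + Pi.single j 1
    · subst h
      simp
    · rw [if_neg (by tauto : ¬ (β = α + Pi.single j 1 ∧ l = k)), mul_zero]
      split_ifs with h'
      · have hj : β j = 0 := by
          by_contra h0
          refine h (funext fun i => ?_)
          rw [← h'.1]
          by_cases hi : i = j
          · subst hi; simp; omega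
          · simp [hi]
        simp [hj]
      · rfl

lemma coeff_dq (j : Fin ν) (F : Obs ν) (α : Fin ν → ℕ) (k : Fin ν → ℤ) :
    (dq j F).coeff (α, k) = Complex.I * k j * F.coeff (α, k) := by
  induction F using AddMonoidAlgebra.induction_linear with
  | zero => simp [dq]
  | add F G hF hG => simp [dq_add, hF, hG, mul_add]
  | single m c =>
    rw [dq_single]
    simp only [AddMonoidAlgebra.coeff_single, Finsupp.single_apply]
    split_ifs with h
    · rw [h]
    · simp

lemma dp_mul (j : Fin ν) (F G : Obs ν) : dp j (F * G) = F * dp j G + G * dp j F := by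
  induction F using AddMonoidAlgebra.induction_linear with
  | zero => simp [dp]
  | add F F' hF hF' => simp only [add_mul, dp_add, hF, hF', mul_add]; ring
  | single m c =>
    induction G using AddMonoidAlgebra.induction_linear with
    | zero => simp [dp]
    | add G G' hG hG' => simp only [add_mul, dp_add, hG, hG', mul_add]; ring
    | single n d =>
      have key : ∀ (m n : (Fin ν → ℕ) × (Fin ν → ℤ)) (c d : ℂ),
          (AddMonoidAlgebra.single m c * dp j (AddMonoidAlgebra.single n d) : Obs ν) =
            AddMonoidAlgebra.single ((m.1 + n.1) - Pi.single j 1, m.2 + n.2)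
              ((n.1 j : ℂ) * (c * d)) := by
        intro m n c d
        rw [dp_single, AddMonoidAlgebra.single_mul_single]
        by_cases h : n.1 j = 0
        · simp [h]
        · congr 1
          · refine Prod.ext (funext fun i => ?_) rfl
            by_cases hi : i = j
            · subst hi; simp; omega
            · simp [hi]
          · ring
      rw [key, key, AddMonoidAlgebra.single_mul_single, dp_single, add_comm n.1, add_comm n.2,
        ← AddMonoidAlgebra.single_add]
      congr 1
      simp only [Prod.fst_add, Pi.add_apply]
      push_cast
      ring

lemma dq_mul (j : Fin ν) (F G : Obs ν) : dq j (F * G) = F * dq j G + G * dq j F := by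
  induction F using AddMonoidAlgebra.induction_linear with
  | zero => simp [dq]
  | add F F' hF hF' => simp only [add_mul, dq_add, hF, hF', mul_add]; ring
  | single m c =>
    induction G using AddMonoidAlgebra.induction_linear with
    | zero => simp [dq]
    | add G G' hG hG' => simp only [add_mul, dq_add, hG, hG', mul_add]; ring
    | single n d =>
      simp only [dq_single, AddMonoidAlgebra.single_mul_single, add_comm n m,
        ← AddMonoidAlgebra.single_add]
      congr 1
      simp only [Prod.snd_add, Pi.add_apply]
      push_cast
      ring

/-- The partial derivatives of observables as derivations. The coordinates of phase space are
indexed by `Fin ν ⊕ Fin ν`: `inl j` stands for `q_j` and `inr j` for `p_j`. -/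
noncomputable def partialDeriv : Fin ν ⊕ Fin ν → Derivation ℂ (Obs ν) (Obs ν)
  | .inl j => Derivation.mk'
      { toFun := dq j
        map_add' := dq_add j
        map_smul' := fun c F => by
          ext ⟨α, k⟩; simp [coeff_dq]; ring } (dq_mul j)
  | .inr j => Derivation.mk'
      { toFun := dp j
        map_add' := dp_add j
        map_smul' := fun c F => by
          ext ⟨α, k⟩; simp [coeff_dp]; ring } (dp_mul j)

lemma partialDeriv_inl (j : Fin ν) (F : Obs ν) : partialDeriv (.inl j) F = dq j F := rfl

lemma partialDeriv_inr (j : Fin ν) (F : Obs ν) : partialDeriv (.inr j) F = dp j F := rfl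

lemma partialDeriv_comm (a b : Fin ν ⊕ Fin ν) (F : Obs ν) :
    partialDeriv a (partialDeriv b F) = partialDeriv b (partialDeriv a F) := by
  ext ⟨α, k⟩
  rcases a with i | i <;> rcases b with j | j <;>
    simp only [partialDeriv_inl, partialDeriv_inr, coeff_dp, coeff_dq]
  · ring
  · ring
  · ring
  · by_cases h : i = j
    · subst h; rfl
    · rw [add_right_comm]
      simp [h, Ne.symm h]
      ring

/-! ### Real observables -/

/-- Complex conjugation of observables at real `(p, q)`: `c p^α e^{i k·q} ↦ c̄ p^α e^{-i k·q}`. -/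
noncomputable def conjObs : Obs ν →+* Obs ν :=
  (AddMonoidAlgebra.mapRingHom ((Fin ν → ℕ) × (Fin ν → ℤ)) (starRingEnd ℂ)).comp
    (AddMonoidAlgebra.mapDomainRingHom ℂ
      ((AddMonoidHom.id (Fin ν → ℕ)).prodMap (-AddMonoidHom.id (Fin ν → ℤ))))

lemma conjObs_single (m : (Fin ν → ℕ) × (Fin ν → ℤ)) (c : ℂ) :
    conjObs (AddMonoidAlgebra.single m c) = AddMonoidAlgebra.single (m.1, -m.2) (star c) := by
  simp [conjObs]
  rfl

lemma coeff_conjObs (F : Obs ν) (α : Fin ν → ℕ) (k : Fin ν → ℤ) :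
    (conjObs F).coeff (α, k) = star (F.coeff (α, -k)) := by
  induction F using AddMonoidAlgebra.induction_linear with
  | zero => simp
  | add F G hF hG => simp [hF, hG]
  | single m c =>
    obtain ⟨β, l⟩ := m
    rw [conjObs_single]
    simp only [AddMonoidAlgebra.coeff_single, Finsupp.single_apply, Prod.mk.injEq, neg_eq_iff_eq_neg]
    split_ifs <;> simp

lemma Obs.isReal_iff_conjObs {F : Obs ν} : F.IsReal ↔ conjObs F = F := by
  constructor
  · intro h
    ext ⟨α, k⟩
    rw [coeff_conjObs, h, star_star]
  · intro h α k
    have hk := coeff_conjObs F α k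
    rw [h] at hk
    rw [hk, star_star]

/-- The real observables form a subring. -/
noncomputable def realObs (ν : ℕ) : Subring (Obs ν) :=
  (conjObs (ν := ν)).eqLocus (RingHom.id _)

lemma mem_realObs {F : Obs ν} : F ∈ realObs ν ↔ F.IsReal :=
  Obs.isReal_iff_conjObs.symm

lemma Obs.IsReal.smul {F : Obs ν} (hF : F.IsReal) (r : ℝ) : Obs.IsReal ((r : ℂ) • F) := by
  intro α k
  simp [hF α k]

lemma Obs.IsReal.partialDeriv {F : Obs ν} (hF : F.IsReal) (a : Fin ν ⊕ Fin ν) :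
    Obs.IsReal (FormalKolmogorov.partialDeriv a F) := by
  rcases a with j | j <;> intro α k
  · simp [partialDeriv_inl, coeff_dq, hF α k]
  · simp [partialDeriv_inr, coeff_dp, hF _ k]

/-! ### Linear transport equations for formal series -/

lemma coeff_complex_smul {A : Type*} [CommRing A] [Algebra ℂ A] (n : ℕ) (c : ℂ)
    (F : PowerSeries A) : PowerSeries.coeff n (c • F) = c • PowerSeries.coeff n F := rfl

/-- The extension of a derivation to power series, coefficient by coefficient. -/
noncomputable def seriesDeriv {A : Type*} [CommRing A] [Algebra ℂ A] (d : Derivation ℂ A A) :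
    Derivation ℂ (PowerSeries A) (PowerSeries A) :=
  Derivation.mk'
    { toFun := fun F => PowerSeries.mk fun n => d (PowerSeries.coeff n F)
      map_add' := fun F G => by ext n; simp
      map_smul' := fun c F => by
        ext n
        rw [RingHom.id_apply, coeff_complex_smul, PowerSeries.coeff_mk, PowerSeries.coeff_mk,
          coeff_complex_smul, d.map_smul] }
    (fun F G => by
      ext n
      simp only [LinearMap.coe_mk, AddHom.coe_mk, PowerSeries.coeff_mk, smul_eq_mul, map_add,
        PowerSeries.coeff_mul, map_sum, Derivation.leibniz, Finset.sum_add_distrib]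
      congr 1
      exact Finset.Nat.sum_antidiagonal_swap.symm)

@[simp] lemma coeff_seriesDeriv {A : Type*} [CommRing A] [Algebra ℂ A] (d : Derivation ℂ A A)
    (F : PowerSeries A) (n : ℕ) :
    PowerSeries.coeff n (seriesDeriv d F) = d (PowerSeries.coeff n F) :=
  PowerSeries.coeff_mk n fun n => d (PowerSeries.coeff n F)

lemma seriesDeriv_C {A : Type*} [CommRing A] [Algebra ℂ A] (d : Derivation ℂ A A) (x : A) :
    seriesDeriv d (PowerSeries.C x) = PowerSeries.C (d x) := by
  ext n
  simp only [coeff_seriesDeriv, PowerSeries.coeff_C]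
  split_ifs <;> simp

/-- The derivative `∑_a w_a ∂_a F` of an observable `F` along a vector field `w`. -/
noncomputable def dirDeriv (w : Fin ν ⊕ Fin ν → Obs ν) (F : Obs ν) : Obs ν :=
  ∑ a, w a * partialDeriv a F

/-- The transport operator `∂_ε - ∑_a v_a ∂_a` of an `ε`-dependent vector field `v`. The series that
it annihilates are those constant along the integral curves of `-v`. -/
noncomputable def transport (v : Fin ν ⊕ Fin ν → FObs ν) : Derivation ℂ (FObs ν) (FObs ν) :=
  (PowerSeries.derivative (Obs ν)).restrictScalars ℂ - ∑ a, v a • seriesDeriv (partialDeriv a)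

lemma transport_apply (v : Fin ν ⊕ Fin ν → FObs ν) (F : FObs ν) :
    transport v F = PowerSeries.derivative (Obs ν) F -
      ∑ a, v a * seriesDeriv (partialDeriv a) F := by
  simp only [transport, Derivation.sub_apply, Derivation.restrictScalars_apply]
  congr 1
  rw [← Derivation.coeFnAddMonoidHom_apply, map_sum, Finset.sum_apply]
  rfl

lemma coeff_transport (v : Fin ν ⊕ Fin ν → FObs ν) (F : FObs ν) (n : ℕ) :
    PowerSeries.coeff n (transport v F) = ((n : ℂ) + 1) • PowerSeries.coeff (n + 1) F -
      ∑ st ∈ Finset.HasAntidiagonal.antidiagonal n,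
        dirDeriv (fun a => PowerSeries.coeff st.1 (v a)) (PowerSeries.coeff st.2 F) := by
  rw [transport_apply, map_sub, PowerSeries.coeff_derivative, map_sum]
  congr 1
  · rw [mul_comm, ← Nat.cast_succ, ← nsmul_eq_mul, ← Nat.cast_succ, Nat.cast_smul_eq_nsmul]
  · simp only [dirDeriv, PowerSeries.coeff_mul, coeff_seriesDeriv]
    exact Finset.sum_comm

lemma transport_eq_iff (v : Fin ν ⊕ Fin ν → FObs ν) (F B : FObs ν) :
    transport v F = B ↔ ∀ n, PowerSeries.coeff (n + 1) F = ((n : ℂ) + 1)⁻¹ •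
      (∑ st ∈ Finset.HasAntidiagonal.antidiagonal n,
        dirDeriv (fun a => PowerSeries.coeff st.1 (v a)) (PowerSeries.coeff st.2 F) +
        PowerSeries.coeff n B) := by
  rw [PowerSeries.ext_iff]
  refine forall_congr' fun n => ?_
  rw [coeff_transport, sub_eq_iff_eq_add', eq_inv_smul_iff₀ (Nat.cast_add_one_ne_zero n)]

/-- A transport equation has at most one solution with given initial value. -/
lemma eq_of_transport_eq {v : Fin ν ⊕ Fin ν → FObs ν} {F G : FObs ν}
    (h : transport v F = transport v G) (h0 : PowerSeries.coeff 0 F = PowerSeries.coeff 0 G) :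
    F = G := by
  ext1 n
  induction n using Nat.strong_induction_on with
  | _ n ih =>
    rcases n with _ | n
    · exact h0
    · rw [(transport_eq_iff v F _).1 h n, (transport_eq_iff v G _).1 rfl n]
      congr 2
      refine Finset.sum_congr rfl fun st hst => ?_
      rw [ih st.2 (by have := Finset.HasAntidiagonal.mem_antidiagonal.1 hst; omega)]

/-- Definition of a sequence by course-of-values recursion. -/
lemma exists_seq_of_recursion {X : Type*} [Nonempty X] (S : ℕ → (ℕ → X) → X)
    (hS : ∀ n x y, (∀ m < n, x m = y m) → S n x = S n y) : ∃ x : ℕ → X, ∀ n, x n = S n x := by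
  classical
  let x0 : X := Classical.arbitrary X
  let x : ℕ → X := fun n => Nat.strongRec (motive := fun _ => X)
    (fun n rec => S n fun m => if h : m < n then rec m h else x0) n
  refine ⟨x, fun n => ?_⟩
  have hx : x n = S n fun m => if m < n then x m else x0 := by
    simp only [x]
    rw [Nat.strongRec]
    rfl
  rw [hx]
  exact hS n _ _ fun m hm => if_pos hm

/-- A transport equation has a solution with given initial value. -/
lemma exists_transport_eq (v : Fin ν ⊕ Fin ν → FObs ν) (u0 : Obs ν) (B : FObs ν) :
    ∃ F : FObs ν, PowerSeries.coeff 0 F = u0 ∧ transport v F = B := by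
  obtain ⟨u, hu⟩ := exists_seq_of_recursion (X := Obs ν)
    (fun n u => match n with
      | 0 => u0
      | n + 1 => ((n : ℂ) + 1)⁻¹ • (∑ st ∈ Finset.HasAntidiagonal.antidiagonal n,
          dirDeriv (fun a => PowerSeries.coeff st.1 (v a)) (u st.2) + PowerSeries.coeff n B))
    (by
      intro n x y h
      rcases n with _ | n
      · rfl
      · dsimp only
        congr 2
        refine Finset.sum_congr rfl fun st hst => ?_
        rw [h st.2 (by have := Finset.HasAntidiagonal.mem_antidiagonal.1 hst; omega)])
  refine ⟨PowerSeries.mk u, ?_, (transport_eq_iff _ _ _).2 fun n => ?_⟩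
  · rw [PowerSeries.coeff_mk, hu]
  · simp only [PowerSeries.coeff_mk]
    exact hu (n + 1)

lemma isReal_dirDeriv {w : Fin ν ⊕ Fin ν → Obs ν} {F : Obs ν} (hw : ∀ a, (w a).IsReal)
    (hF : F.IsReal) : Obs.IsReal (dirDeriv w F) :=
  mem_realObs.1 <| sum_mem fun a _ =>
    mul_mem (mem_realObs.2 (hw a)) (mem_realObs.2 (hF.partialDeriv a))

lemma Obs.IsReal.inv_smul {F : Obs ν} (hF : F.IsReal) (n : ℕ) :
    Obs.IsReal (((n : ℂ) + 1)⁻¹ • F) := by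
  have h := hF.smul ((n : ℝ) + 1)⁻¹
  push_cast at h
  exact h

/-- Solutions of transport equations with real data are real. -/
lemma isReal_of_transport_eq {v : Fin ν ⊕ Fin ν → FObs ν} {F B : FObs ν}
    (hv : ∀ a, (v a).IsReal) (hB : B.IsReal) (h0 : (PowerSeries.coeff 0 F).IsReal)
    (h : transport v F = B) : F.IsReal := by
  intro n
  induction n using Nat.strong_induction_on with
  | _ n ih =>
    rcases n with _ | n
    · exact h0
    · rw [(transport_eq_iff v F _).1 h n]
      refine Obs.IsReal.inv_smul (mem_realObs.1 (add_mem (sum_mem fun st hst => ?_)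
        (mem_realObs.2 (hB n)))) n
      exact mem_realObs.2 (isReal_dirDeriv (fun a => hv a _)
        (ih _ (by have := Finset.HasAntidiagonal.mem_antidiagonal.1 hst; omega)))

/-- The commutator of the transport operator with a partial derivative. -/
lemma transport_partialDeriv (v : Fin ν ⊕ Fin ν → FObs ν) (a : Fin ν ⊕ Fin ν) (F : FObs ν) :
    transport v (seriesDeriv (partialDeriv a) F) = seriesDeriv (partialDeriv a) (transport v F) +
      ∑ b, seriesDeriv (partialDeriv a) (v b) * seriesDeriv (partialDeriv b) F := by
  have hX : PowerSeries.derivative (Obs ν) (seriesDeriv (partialDeriv a) F) =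
      seriesDeriv (partialDeriv a) (PowerSeries.derivative (Obs ν) F) := by
    ext1 n
    have hn : partialDeriv a ((n : Obs ν) + 1) = 0 := by
      have := (partialDeriv (ν := ν) a).map_natCast (n + 1)
      push_cast at this
      exact this
    simp [PowerSeries.coeff_derivative, hn, mul_comm]
  have hc : ∀ b, seriesDeriv (partialDeriv a) (seriesDeriv (partialDeriv b) F) =
      seriesDeriv (partialDeriv b) (seriesDeriv (partialDeriv a) F) := fun b => by
    ext1 n
    simp [partialDeriv_comm]
  simp only [transport_apply, map_sub, map_sum, Derivation.leibniz, smul_eq_mul, hX, hc,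
    Finset.sum_add_distrib]
  have : ∑ b, seriesDeriv (partialDeriv b) F * seriesDeriv (partialDeriv a) (v b) =
      ∑ b, seriesDeriv (partialDeriv a) (v b) * seriesDeriv (partialDeriv b) F :=
    Finset.sum_congr rfl fun b _ => mul_comm _ _
  rw [this]
  ring

/-! ### The exponential of a formal series -/

/-- Truncation of the exponential series. -/
lemma X_pow_dvd_expSeries_sub {g : FObs ν} (hg : PowerSeries.coeff 0 g = 0) (M : ℕ) :
    PowerSeries.X ^ M ∣
      expSeries g - ∑ m ∈ Finset.range M, ((m.factorial : ℂ)⁻¹) • g ^ m := by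
  rw [PowerSeries.X_pow_dvd_iff]
  intro n hn
  have hXg : PowerSeries.X ∣ g := PowerSeries.X_dvd_iff.2 (by simpa using hg)
  rw [map_sub, sub_eq_zero, map_sum, expSeries, PowerSeries.coeff_mk]
  simp only [coeff_complex_smul]
  refine Finset.sum_subset (Finset.range_subset_range.2 hn) fun m _ hm => ?_
  rw [PowerSeries.X_pow_dvd_iff.1 (pow_dvd_pow_of_dvd hXg m) n (by simpa using hm), smul_zero]

lemma constantCoeff_expSeries (g : FObs ν) : PowerSeries.constantCoeff (expSeries g) = 1 := by
  rw [← PowerSeries.coeff_zero_eq_constantCoeff_apply, expSeries, PowerSeries.coeff_mk]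
  simp

lemma derivation_X_pow_dvd (D : Derivation ℂ (FObs ν) (FObs ν)) {M : ℕ} {F : FObs ν}
    (h : PowerSeries.X ^ (M + 1) ∣ F) : PowerSeries.X ^ M ∣ D F := by
  obtain ⟨U, rfl⟩ := h
  rw [D.leibniz, D.leibniz_pow, Nat.add_sub_cancel]
  simp only [smul_eq_mul]
  refine dvd_add ?_ ?_
  · exact (pow_dvd_pow _ M.le_succ).mul_right _
  · refine Dvd.dvd.mul_left ?_ _
    rw [nsmul_eq_mul]
    exact (dvd_mul_right _ _).mul_left _

/-- Every derivation obeys the chain rule for the exponential. -/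
lemma derivation_expSeries (D : Derivation ℂ (FObs ν) (FObs ν)) {g : FObs ν}
    (hg : PowerSeries.coeff 0 g = 0) : D (expSeries g) = D g * expSeries g := by
  have hT : ∀ M, D (∑ m ∈ Finset.range (M + 1), ((m.factorial : ℂ)⁻¹) • g ^ m) =
      D g * ∑ m ∈ Finset.range M, ((m.factorial : ℂ)⁻¹) • g ^ m := by
    intro M
    rw [Finset.sum_range_succ', map_add, map_sum, Finset.mul_sum]
    simp only [pow_zero, D.map_smul, D.map_one_eq_zero, smul_zero, add_zero]
    refine Finset.sum_congr rfl fun m _ => ?_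
    rw [D.leibniz_pow, Nat.add_sub_cancel, ← Nat.cast_smul_eq_nsmul ℂ, smul_smul, smul_eq_mul,
      mul_smul_comm, mul_comm (D g)]
    congr 1
    rw [Nat.factorial_succ]
    have := Nat.cast_add_one_ne_zero (R := ℂ) m
    push_cast
    field_simp
  have hdvd : ∀ M, PowerSeries.X ^ M ∣ D (expSeries g) - D g * expSeries g := by
    intro M
    have h1 := derivation_X_pow_dvd D (X_pow_dvd_expSeries_sub hg (M + 1))
    have h2 := (X_pow_dvd_expSeries_sub hg M).mul_left (D g)
    rw [map_sub, hT] at h1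
    convert dvd_sub h1 h2 using 1
    ring
  rw [← sub_eq_zero]
  ext1 n
  exact PowerSeries.X_pow_dvd_iff.1 (hdvd (n + 1)) n n.lt_succ_self

/-! ### Substitution along the flow of a vector field -/

/-- `Φ` is the flow of the `ε`-dependent vector field `v`, in the sense that the components `Z_a`
of its displacement solve `∂_ε Z_a = v_a + ∑_b v_b ∂_b Z_a`. Then `Φ` is constant along the integral
curves of `-v`, so it is the inverse of the flow of `-v` in the usual sense; this is the flow of `v`
itself if `v` does not depend on `ε`. -/
def FormalTransformation.IsFlow (Φ : FormalTransformation ν) (v : Fin ν ⊕ Fin ν → FObs ν) : Prop :=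
  ∀ a, transport v (Sum.elim Φ.Q Φ.P a) = v a

/-- A real vector field has a flow. -/
lemma exists_isFlow {v : Fin ν ⊕ Fin ν → FObs ν} (hv : ∀ a, (v a).IsReal) :
    ∃ Φ : FormalTransformation ν, Φ.IsFlow v := by
  choose Z hZ0 hZ using fun a => exists_transport_eq v 0 (v a)
  have hr : ∀ a, (Z a).IsReal := fun a =>
    isReal_of_transport_eq hv (hv a) (by rw [hZ0]; exact mem_realObs.1 (zero_mem _)) (hZ a)
  exact ⟨⟨fun j => Z (.inl j), fun j => Z (.inr j), fun j => hZ0 _, fun j => hZ0 _,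
    fun j => hr _, fun j => hr _⟩, fun a => by rcases a with j | j <;> exact hZ _⟩

lemma transport_C (v : Fin ν ⊕ Fin ν → FObs ν) (x : Obs ν) :
    transport v (PowerSeries.C x) = -∑ a, v a * PowerSeries.C (partialDeriv a x) := by
  rw [transport_apply]
  simp [seriesDeriv_C]

lemma partialDeriv_inl_pVar (i j : Fin ν) : partialDeriv (.inl i) (pVar j) = 0 := by
  simp [partialDeriv_inl, pVar, dq_single]

lemma partialDeriv_inr_pVar (i j : Fin ν) :
    partialDeriv (.inr i) (pVar j) = if i = j then 1 else 0 := by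
  rw [partialDeriv_inr, pVar, dp_single]
  split_ifs with h
  · subst h
    simp [AddMonoidAlgebra.one_def]
    rfl
  · simp [h]

lemma partialDeriv_inl_expq (i : Fin ν) (k : Fin ν → ℤ) :
    partialDeriv (.inl i) (expq k) = (Complex.I * k i) • expq k := by
  simp [partialDeriv_inl, expq, dq_single]

lemma partialDeriv_inr_expq (i : Fin ν) (k : Fin ν → ℤ) :
    partialDeriv (.inr i) (expq k) = 0 := by
  simp [partialDeriv_inr, expq, dp_single]

lemma partialDeriv_single_zero (a : Fin ν ⊕ Fin ν) (c : ℂ) :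
    partialDeriv a (AddMonoidAlgebra.single 0 c) = 0 := by
  rcases a with j | j
  · simp [partialDeriv_inl, dq_single]
  · simp [partialDeriv_inr, dp_single]

namespace FormalTransformation

variable {Φ : FormalTransformation ν} {v : Fin ν ⊕ Fin ν → FObs ν}

lemma IsFlow.transport_momentum (h : Φ.IsFlow v) (j : Fin ν) :
    transport v (PowerSeries.C (pVar j) + Φ.P j) = 0 := by
  have hP : transport v (Φ.P j) = v (.inr j) := h (.inr j)
  rw [map_add, hP, transport_C]
  simp [Fintype.sum_sum_type, partialDeriv_inl_pVar, partialDeriv_inr_pVar, apply_ite]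

lemma IsFlow.transport_phase (h : Φ.IsFlow v) (k : Fin ν → ℤ) :
    transport v (PowerSeries.C (expq k) *
      expSeries (∑ j, (Complex.I * (k j : ℂ)) • Φ.Q j)) = 0 := by
  have hQ : ∀ j, transport v (Φ.Q j) = v (.inl j) := fun j => h (.inl j)
  have h0 : PowerSeries.coeff 0 (∑ j, (Complex.I * (k j : ℂ)) • Φ.Q j) = 0 := by
    rw [map_sum]
    exact Finset.sum_eq_zero fun j _ => by rw [coeff_complex_smul, Φ.Q_zero, smul_zero]
  have hC : ∀ j, v (.inl j) * PowerSeries.C ((Complex.I * (k j : ℂ)) • expq k) =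
      (Complex.I * (k j : ℂ)) • v (.inl j) * PowerSeries.C (expq k) := by
    intro j
    rw [smul_mul_assoc, ← mul_smul_comm]
    congr 1
    ext1 n
    rw [coeff_complex_smul, PowerSeries.coeff_C, PowerSeries.coeff_C]
    split_ifs <;> simp
  rw [Derivation.leibniz, derivation_expSeries _ h0, transport_C, map_sum]
  simp only [Fintype.sum_sum_type, partialDeriv_inl_expq, partialDeriv_inr_expq, hC,
    Derivation.map_smul, hQ, map_zero, mul_zero, Finset.sum_const_zero, add_zero, smul_eq_mul,
    ← Finset.sum_mul]
  ring

/-- Observables pulled back by the flow of `v` are annihilated by the transport operator. -/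
lemma IsFlow.transport_subst (h : Φ.IsFlow v) (F : Obs ν) : transport v (Φ.subst F) = 0 := by
  have hmul : ∀ {x y : FObs ν}, transport v x = 0 → transport v y = 0 →
      transport v (x * y) = 0 := fun hx hy => by simp [hx, hy]
  rw [subst, Finsupp.sum, map_sum]
  refine Finset.sum_eq_zero fun m _ => ?_
  rw [mul_assoc]
  refine hmul (hmul ?_ ?_) (h.transport_phase m.2)
  · rw [transport_C]
    simp [partialDeriv_single_zero]
  · refine Finset.prod_induction _ (fun x => transport v x = 0) (fun _ _ => hmul)
      (Derivation.map_one_eq_zero _) fun j _ => ?_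
    rw [Derivation.leibniz_pow, h.transport_momentum]
    simp

lemma coeff_zero_subst (Φ : FormalTransformation ν) (F : Obs ν) :
    PowerSeries.coeff 0 (Φ.subst F) = F := by
  have hP : ∀ j, PowerSeries.constantCoeff (Φ.P j) = 0 := fun j => by
    rw [← PowerSeries.coeff_zero_eq_constantCoeff_apply, Φ.P_zero]
  have hp : ∀ α : Fin ν → ℕ, ∏ j, (pVar j : Obs ν) ^ α j = AddMonoidAlgebra.single (α, 0) 1 := by
    intro α
    simp only [pVar, AddMonoidAlgebra.single_pow, one_pow, AddMonoidAlgebra.prod_single,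
      Finset.prod_const_one]
    congr 1
    refine Prod.ext (funext fun i => ?_) (by simp [Prod.snd_sum])
    simp [Prod.fst_sum, Finset.sum_apply, Pi.single_apply]
  have hF : F.coeff.sum AddMonoidAlgebra.single = F := by
    ext1
    rw [AddMonoidAlgebra.coeff_finsuppSum]
    exact F.coeff.sum_single
  conv_rhs => rw [← hF]
  rw [PowerSeries.coeff_zero_eq_constantCoeff_apply, subst, Finsupp.sum, map_sum]
  refine Finset.sum_congr rfl fun m _ => ?_
  simp only [map_mul, map_prod, map_pow, map_add, PowerSeries.constantCoeff_C, hP, add_zero,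
    constantCoeff_expSeries, mul_one, hp, expq, AddMonoidAlgebra.single_mul_single]
  simp

/-- The pullback of `F_0 + ε F_1`. -/
lemma pullback_C_add_X_mul_C (Φ : FormalTransformation ν) (F G : Obs ν) :
    Φ.pullback (PowerSeries.C F + PowerSeries.X * PowerSeries.C G) =
      Φ.subst F + PowerSeries.X * Φ.subst G := by
  have hsucc : ∀ s, PowerSeries.coeff (s + 1)
      (PowerSeries.C F + PowerSeries.X * PowerSeries.C G) =
        PowerSeries.coeff s (PowerSeries.C G) := fun s => by
    rw [map_add, PowerSeries.coeff_succ_C, zero_add, PowerSeries.coeff_succ_X_mul]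
  have hzero : PowerSeries.coeff 0 (PowerSeries.C F + PowerSeries.X * PowerSeries.C G) = F := by
    simp
  have hsubst : Φ.subst 0 = 0 := by simp [subst]
  ext1 n
  rw [pullback, PowerSeries.coeff_mk, Finset.Nat.sum_antidiagonal_eq_sum_range_succ_mk]
  rcases n with _ | n
  · rw [Finset.sum_range_one, hzero]
    simp
  · rw [Finset.sum_range_succ', Finset.sum_range_succ']
    simp only [hsucc, PowerSeries.coeff_succ_C, PowerSeries.coeff_zero_C, hsubst, map_zero,
      Finset.sum_const_zero, hzero, zero_add, Nat.sub_zero, Nat.add_sub_cancel, map_add,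
      PowerSeries.coeff_succ_X_mul]
    rw [add_comm]

end FormalTransformation

/-! ### Flows of Hamiltonian fields are canonical -/

/-- A vector field on phase space is (locally) Hamiltonian when its interior product with the
symplectic form is closed, i.e. when it satisfies the symmetry of the second derivatives of a
generating function. The generating function itself may contain terms linear in `q`, which are not
observables. -/
structure IsHamiltonianField (w : Fin ν ⊕ Fin ν → Obs ν) : Prop where
  dp_inl : ∀ i j, dp i (w (.inl j)) = dp j (w (.inl i))
  dq_inr : ∀ i j, dq i (w (.inr j)) = dq j (w (.inr i))
  dq_inl : ∀ i j, dq i (w (.inl j)) = -dp j (w (.inr i))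

/-- The matrix `(∂_a v_b)_{b, a}` of partial derivatives of a vector field. -/
noncomputable def fieldJacobian (v : Fin ν ⊕ Fin ν → FObs ν) :
    Matrix (Fin ν ⊕ Fin ν) (Fin ν ⊕ Fin ν) (FObs ν) :=
  Matrix.of fun b a => seriesDeriv (partialDeriv a) (v b)

/-- The Jacobian matrix of a Hamiltonian field lies in the symplectic Lie algebra. -/
lemma fieldJacobian_mul_J {v : Fin ν ⊕ Fin ν → FObs ν}
    (hv : ∀ n, IsHamiltonianField fun a => PowerSeries.coeff n (v a)) :
    fieldJacobian v * Matrix.J (Fin ν) (FObs ν) +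
      Matrix.J (Fin ν) (FObs ν) * (fieldJacobian v).transpose = 0 := by
  have hB : fieldJacobian v = Matrix.fromBlocks
      (Matrix.of fun i j => seriesDeriv (partialDeriv (.inl j)) (v (.inl i)))
      (Matrix.of fun i j => seriesDeriv (partialDeriv (.inr j)) (v (.inl i)))
      (Matrix.of fun i j => seriesDeriv (partialDeriv (.inl j)) (v (.inr i)))
      (Matrix.of fun i j => seriesDeriv (partialDeriv (.inr j)) (v (.inr i))) := by
    ext1 (a | a) (b | b) <;> rfl
  rw [hB, Matrix.J, Matrix.fromBlocks_transpose, Matrix.fromBlocks_multiply,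
    Matrix.fromBlocks_multiply, Matrix.fromBlocks_add, ← Matrix.fromBlocks_zero]
  congr 1 <;> ext i j n : 3 <;>
    simp [partialDeriv_inl, partialDeriv_inr, (hv n).dp_inl i j, (hv n).dq_inr i j,
      (hv n).dq_inl]

lemma map_derivation_mul {m n o : Type*} [Fintype n] {A : Type*} [CommRing A] [Algebra ℂ A]
    (D : Derivation ℂ A A) (M : Matrix m n A) (N : Matrix n o A) :
    (M * N).map D = M.map D * N + M * N.map D := by
  ext i j
  simp only [Matrix.map_apply, Matrix.mul_apply, map_sum, Derivation.leibniz, smul_eq_mul,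
    Matrix.add_apply, Finset.sum_add_distrib]
  rw [add_comm]
  congr 1
  exact Finset.sum_congr rfl fun _ _ => mul_comm _ _

lemma map_derivation_J {A : Type*} [CommRing A] [Algebra ℂ A] (D : Derivation ℂ A A) :
    (Matrix.J (Fin ν) A).map D = 0 := by
  ext (i | i) (j | j) <;> simp [Matrix.J, Matrix.one_apply, apply_ite]

namespace FormalTransformation

variable {Φ : FormalTransformation ν} {v : Fin ν ⊕ Fin ν → FObs ν}

lemma jacobian_apply (Φ : FormalTransformation ν) (a b : Fin ν ⊕ Fin ν) :
    Φ.jacobian a b = (1 : Matrix _ _ (FObs ν)) a b +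
      seriesDeriv (partialDeriv b) (Sum.elim Φ.Q Φ.P a) := by
  rcases a with i | i <;> rcases b with j | j <;>
    simp [jacobian, Matrix.one_apply] <;> rfl

/-- The variational equation: the Jacobian matrix `M` of the flow of `v` solves `δM = M B`, with
`δ` the transport operator and `B` the Jacobian matrix of `v`. -/
lemma IsFlow.transport_jacobian (h : Φ.IsFlow v) :
    Φ.jacobian.map (transport v) = Φ.jacobian * fieldJacobian v := by
  ext1 a b
  have h1 : transport v ((1 : Matrix _ _ (FObs ν)) a b) = 0 := by
    rw [Matrix.one_apply]
    split_ifs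
    · exact Derivation.map_one_eq_zero _
    · exact map_zero _
  simp only [Matrix.map_apply, jacobian_apply, map_add, transport_partialDeriv, h1, h a, zero_add,
    Matrix.mul_apply, add_mul, Finset.sum_add_distrib, fieldJacobian, Matrix.of_apply]
  congr 1
  · simp [Matrix.one_apply]
  · exact Finset.sum_congr rfl fun _ _ => mul_comm _ _

lemma constantCoeff_jacobian (Φ : FormalTransformation ν) :
    Φ.jacobian.map PowerSeries.constantCoeff = 1 := by
  ext1 a b
  have hZ : PowerSeries.coeff 0 (Sum.elim Φ.Q Φ.P a) = 0 := by
    rcases a with j | j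
    · exact Φ.Q_zero j
    · exact Φ.P_zero j
  rw [Matrix.map_apply, jacobian_apply, map_add,
    ← PowerSeries.coeff_zero_eq_constantCoeff_apply (seriesDeriv _ _), coeff_seriesDeriv, hZ,
    map_zero, add_zero, Matrix.one_apply, Matrix.one_apply]
  split_ifs <;> simp

/-- The flow of a Hamiltonian field is canonical: `M J Mᵀ` is annihilated by the transport operator
and equals `J` at `ε = 0`. -/
lemma IsFlow.isCanonical (h : Φ.IsFlow v)
    (hv : ∀ n, IsHamiltonianField fun a => PowerSeries.coeff n (v a)) : Φ.IsCanonical := by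
  set M := Φ.jacobian with hM
  set J := Matrix.J (Fin ν) (FObs ν) with hJ
  have hδ : (M * J * M.transpose).map (transport v) = 0 := by
    rw [map_derivation_mul, map_derivation_mul, map_derivation_J, Matrix.transpose_map,
      h.transport_jacobian, Matrix.transpose_mul, Matrix.mul_zero, add_zero]
    calc M * fieldJacobian v * J * M.transpose +
          M * J * ((fieldJacobian v).transpose * M.transpose) =
        M * (fieldJacobian v * J + J * (fieldJacobian v).transpose) * M.transpose := by
          noncomm_ring
      _ = 0 := by rw [fieldJacobian_mul_J hv, Matrix.mul_zero, Matrix.zero_mul]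
  have h0 : (M * J * M.transpose).map PowerSeries.constantCoeff =
      J.map PowerSeries.constantCoeff := by
    rw [Matrix.map_mul, Matrix.map_mul, Matrix.transpose_map, hM, constantCoeff_jacobian]
    simp
  change M * J * M.transpose = J
  ext1 a b
  refine eq_of_transport_eq (v := v) ?_ ?_
  · exact (congrFun₂ hδ a b).trans (congrFun₂ (map_derivation_J (transport v)) a b).symm
  · simpa only [PowerSeries.coeff_zero_eq_constantCoeff_apply, Matrix.map_apply] using
      congrFun₂ h0 a b

end FormalTransformation

/-! ### The homological equation -/

/-- The integrable Hamiltonian `ω · p + p² / 2`. -/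
noncomputable def integrable (ω : Fin ν → ℝ) : Obs ν :=
  omegaDot ω + (1 / 2 : ℂ) • ∑ j, pVar j ^ 2

/-- `F` is a constant plus `O(p²)`. -/
def IsConstAddOSq (F : Obs ν) : Prop :=
  ∀ (α : Fin ν → ℕ) (k : Fin ν → ℤ), ∑ j, α j < 2 → (α ≠ 0 ∨ k ≠ 0) → F.coeff (α, k) = 0

/-- The part of degree `d` in `p` of the solution `W` of `ω · ∂W/∂q = F - ⟨F⟩`, where `⟨F⟩` is the
average over the angles. At `k = 0` the convention `0⁻¹ = 0` selects the solution without average. -/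
noncomputable def solveDeg (ω : Fin ν → ℝ) (d : ℕ) (F : Obs ν) : Obs ν :=
  .ofCoeff <| Finsupp.onFinset F.coeff.support
    (fun m => if ∑ j, m.1 j = d then (Complex.I * ∑ j, (m.2 j : ℂ) * ω j)⁻¹ * F.coeff m else 0)
    (fun m hm => by
      rw [Finsupp.mem_support_iff]
      intro h
      simp [h] at hm)

lemma coeff_solveDeg (ω : Fin ν → ℝ) (d : ℕ) (F : Obs ν) (α : Fin ν → ℕ) (k : Fin ν → ℤ) :
    (solveDeg ω d F).coeff (α, k) =
      if ∑ j, α j = d then (Complex.I * ∑ j, (k j : ℂ) * ω j)⁻¹ * F.coeff (α, k) else 0 := rfl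

lemma Obs.IsReal.solveDeg {F : Obs ν} (hF : F.IsReal) (ω : Fin ν → ℝ) (d : ℕ) :
    Obs.IsReal (FormalKolmogorov.solveDeg ω d F) := by
  intro α k
  rw [coeff_solveDeg, coeff_solveDeg, hF]
  split_ifs <;> simp

lemma isReal_single_zero {c : ℂ} (hc : star c = c) :
    Obs.IsReal (AddMonoidAlgebra.single 0 c : Obs ν) :=
  Obs.isReal_iff_conjObs.2 <| by rw [conjObs_single, hc]; simp; rfl

lemma isReal_pVar (j : Fin ν) : Obs.IsReal (pVar j) :=
  Obs.isReal_iff_conjObs.2 <| by rw [pVar, conjObs_single]; simp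

lemma isReal_integrable (ω : Fin ν → ℝ) : Obs.IsReal (integrable ω) := by
  refine mem_realObs.1 (add_mem (sum_mem fun j _ => mem_realObs.2 ((isReal_pVar j).smul _))
    (mem_realObs.2 ?_))
  have h := (mem_realObs.1 (sum_mem (t := Finset.univ) fun j _ =>
    pow_mem (mem_realObs.2 (isReal_pVar (ν := ν) j)) 2)).smul (1 / 2)
  push_cast at h
  exact h

lemma partialDeriv_inl_integrable (ω : Fin ν → ℝ) (i : Fin ν) :
    partialDeriv (.inl i) (integrable ω) = 0 := by
  simp [integrable, omegaDot, partialDeriv_inl_pVar, Derivation.leibniz_pow]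

lemma partialDeriv_inr_integrable (ω : Fin ν → ℝ) (i : Fin ν) :
    partialDeriv (.inr i) (integrable ω) = (ω i : ℂ) • 1 + pVar i := by
  simp only [integrable, omegaDot, map_add, map_sum, Derivation.map_smul, partialDeriv_inr_pVar,
    Derivation.leibniz_pow, smul_ite, smul_zero, Finset.sum_ite_eq, Finset.mem_univ, if_true]
  congr 1
  simp [← Nat.cast_smul_eq_nsmul ℂ, smul_smul]

lemma coeff_pVar_mul (j : Fin ν) (F : Obs ν) (α : Fin ν → ℕ) (k : Fin ν → ℤ) :
    (pVar j * F).coeff (α, k) = if α j = 0 then 0 else F.coeff (α - Pi.single j 1, k) := by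
  induction F using AddMonoidAlgebra.induction_linear with
  | zero => simp
  | add F G hF hG =>
    rw [mul_add, AddMonoidAlgebra.coeff_add, Finsupp.add_apply, hF, hG]
    split_ifs <;> simp
  | single m c =>
    obtain ⟨β, l⟩ := m
    rw [pVar, AddMonoidAlgebra.single_mul_single]
    simp only [AddMonoidAlgebra.coeff_single, Finsupp.single_apply, Prod.mk_add_mk, Prod.mk.injEq,
      zero_add, one_mul]
    by_cases h : α j = 0
    · rw [if_pos h, if_neg]
      rintro ⟨rfl, -⟩
      simp at h
    · rw [if_neg h]
      have : Pi.single j 1 + β = α ↔ β = α - Pi.single j 1 := by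
        constructor
        · rintro rfl
          simp
        · rintro rfl
          funext i
          by_cases hi : i = j
          · subst hi; simp; omega
          · simp [hi]
      simp only [this]

lemma coeff_sum_pVar_mul_zero (G : Fin ν → Obs ν) (k : Fin ν → ℤ) :
    (∑ j, pVar j * G j).coeff (0, k) = 0 := by
  simp [coeff_pVar_mul, Finsupp.finsetSum_apply]

lemma coeff_sum_pVar_mul_single (G : Fin ν → Obs ν) (i : Fin ν) (k : Fin ν → ℤ) :
    (∑ j, pVar j * G j).coeff (Pi.single i 1, k) = (G i).coeff (0, k) := by
  rw [AddMonoidAlgebra.coeff_sum, Finsupp.finsetSum_apply, Finset.sum_eq_single i]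
  · simp [coeff_pVar_mul]
  · intro j _ hj
    simp [coeff_pVar_mul, hj]
  · simp

lemma eq_zero_or_eq_single_of_sum_lt_two {α : Fin ν → ℕ} (h : ∑ j, α j < 2) :
    α = 0 ∨ ∃ i, α = Pi.single i 1 := by
  by_cases h0 : α = 0
  · exact .inl h0
  · obtain ⟨i, hi⟩ := Function.ne_iff.1 h0
    refine .inr ⟨i, funext fun j => ?_⟩
    have hi' : α i ≠ 0 := hi
    rw [← Finset.add_sum_erase _ _ (Finset.mem_univ i)] at h
    by_cases hj : j = i
    · subst hj
      simp
      omega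
    · have := Finset.single_le_sum (f := α) (fun _ _ => Nat.zero_le _)
        (Finset.mem_erase.2 ⟨hj, Finset.mem_univ j⟩)
      simp [hj]
      omega

/-- The homological equation: for nonresonant `ω`, a Hamiltonian field `w` can be chosen so that
the derivative of `ω · p + p² / 2` along `w` cancels a given real `Z` up to a constant and `O(p²)`.
The generating function is `ξ · q + W₀(q) + W₁(p, q)` with `W₁` linear in `p`: the term `W₀` removes
the terms of `Z` independent of `p`, `W₁` removes the oscillating terms linear in `p`, including the
ones due to `W₀`, and `ξ`, which acts through the twist `p² / 2`, removes the average of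
the terms linear in `p`. -/
lemma exists_field_homological {ω : Fin ν → ℝ}
    (hω : ∀ k : Fin ν → ℤ, k ≠ 0 → ∑ j, (k j : ℝ) * ω j ≠ 0) {Z : Obs ν} (hZ : Z.IsReal) :
    ∃ w : Fin ν ⊕ Fin ν → Obs ν, IsHamiltonianField w ∧ (∀ a, (w a).IsReal) ∧
      IsConstAddOSq (dirDeriv w (integrable ω) + Z) := by
  set ξ : Fin ν → ℂ := fun j => Z.coeff (Pi.single j 1, 0) with hξ
  set W₀ : Obs ν := solveDeg ω 0 Z with hW₀
  set W₁ : Obs ν := solveDeg ω 1 (Z - ∑ j, pVar j * partialDeriv (.inl j) W₀) with hW₁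
  have hW₀real : W₀.IsReal := hZ.solveDeg ω 0
  have hWreal : Obs.IsReal (W₀ + W₁) := by
    refine mem_realObs.1 (add_mem (mem_realObs.2 hW₀real)
      (mem_realObs.2 (Obs.IsReal.solveDeg ?_ _ _)))
    exact mem_realObs.1 (sub_mem (mem_realObs.2 hZ) (sum_mem fun j _ =>
      mul_mem (mem_realObs.2 (isReal_pVar j)) (mem_realObs.2 (hW₀real.partialDeriv _))))
  set W : Obs ν := W₀ + W₁ with hW
  have hξreal : ∀ j, star (ξ j) = ξ j := fun j => by
    rw [hξ]
    simpa using (hZ (Pi.single j 1) 0).symm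
  let w : Fin ν ⊕ Fin ν → Obs ν := Sum.elim (fun j => partialDeriv (.inr j) W)
    (fun j => -AddMonoidAlgebra.single 0 (ξ j) - partialDeriv (.inl j) W)
  have hcomm := fun a b => partialDeriv_comm (ν := ν) a b W
  refine ⟨w, ⟨fun i j => hcomm (.inr i) (.inr j), fun i j => ?_, fun i j => ?_⟩, ?_, ?_⟩
  · simp only [w, Sum.elim_inr, ← partialDeriv_inl, map_sub, map_neg, partialDeriv_single_zero]
    rw [hcomm]
  · simp only [w, Sum.elim_inr, Sum.elim_inl, ← partialDeriv_inl, ← partialDeriv_inr, map_sub,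
      map_neg, partialDeriv_single_zero]
    rw [hcomm]
    simp
  · rintro (j | j)
    · exact hWreal.partialDeriv _
    · exact mem_realObs.1 (sub_mem (neg_mem (mem_realObs.2 (isReal_single_zero (hξreal j))))
        (mem_realObs.2 (hWreal.partialDeriv _)))
  · have hdir : dirDeriv w (integrable ω) =
        ∑ j, (ω j : ℂ) • w (.inr j) + ∑ j, pVar j * w (.inr j) := by
      simp only [dirDeriv, Fintype.sum_sum_type, partialDeriv_inl_integrable,
        partialDeriv_inr_integrable, mul_zero, Finset.sum_const_zero, zero_add, mul_add,
        mul_smul_comm, mul_one, Finset.sum_add_distrib]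
      congr 1
      exact Finset.sum_congr rfl fun _ _ => mul_comm _ _
    have hw : ∀ j α k, (w (.inr j)).coeff (α, k) =
        -(if α = 0 ∧ k = 0 then ξ j else 0) - Complex.I * k j * W.coeff (α, k) := by
      intro j α k
      simp only [w, Sum.elim_inr, partialDeriv_inl, AddMonoidAlgebra.coeff_sub,
        AddMonoidAlgebra.coeff_neg, Finsupp.sub_apply, Finsupp.neg_apply, coeff_dq,
        AddMonoidAlgebra.coeff_single, Finsupp.single_apply]
      simp only [Prod.ext_iff, Prod.fst_zero, Prod.snd_zero, eq_comm (a := (0 : Fin ν → ℕ)),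
        eq_comm (a := (0 : Fin ν → ℤ))]
    have hsolve : ∀ k : Fin ν → ℤ, k ≠ 0 → ∀ x : ℂ,
        ∑ j, (ω j : ℂ) * (-(Complex.I * k j * ((Complex.I * ∑ j, (k j : ℂ) * ω j)⁻¹ * x))) = -x := by
      intro k hk x
      have h : (Complex.I * ∑ j, (k j : ℂ) * ω j) ≠ 0 := by
        refine mul_ne_zero Complex.I_ne_zero ?_
        exact_mod_cast hω k hk
      calc _ = -((Complex.I * ∑ j, (k j : ℂ) * ω j) *
            ((Complex.I * ∑ j, (k j : ℂ) * ω j)⁻¹ * x)) := by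
            generalize (Complex.I * ∑ j, (k j : ℂ) * ω j)⁻¹ * x = y
            rw [Finset.mul_sum, Finset.sum_mul, ← Finset.sum_neg_distrib]
            exact Finset.sum_congr rfl fun _ _ => by ring
        _ = -x := by rw [mul_inv_cancel_left₀ h]
    intro α k hα hne
    have hlin : (∑ j, (ω j : ℂ) • w (.inr j)).coeff (α, k) =
        ∑ j, (ω j : ℂ) * (w (.inr j)).coeff (α, k) := by
      rw [AddMonoidAlgebra.coeff_sum, Finsupp.finsetSum_apply]
      rfl
    rw [hdir, AddMonoidAlgebra.coeff_add, AddMonoidAlgebra.coeff_add, Finsupp.add_apply,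
      Finsupp.add_apply, hlin]
    rcases eq_zero_or_eq_single_of_sum_lt_two hα with rfl | ⟨i, rfl⟩
    · have hk : k ≠ 0 := by simpa using hne
      have hWk : W.coeff (0, k) = (Complex.I * ∑ j, (k j : ℂ) * ω j)⁻¹ * Z.coeff (0, k) := by
        rw [hW, AddMonoidAlgebra.coeff_add, Finsupp.add_apply, hW₀, hW₁, coeff_solveDeg,
          coeff_solveDeg]
        simp
      simp only [hw, hk, and_false, if_false, neg_zero, zero_sub, hWk]
      rw [coeff_sum_pVar_mul_zero, hsolve k hk]
      ring
    · have hsingle : (Pi.single i 1 : Fin ν → ℕ) ≠ 0 := by simp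
      have hdeg : ∑ j, (Pi.single i 1 : Fin ν → ℕ) j = 1 := by simp
      have hWi : W.coeff (Pi.single i 1, k) = (Complex.I * ∑ j, (k j : ℂ) * ω j)⁻¹ *
          (Z.coeff (Pi.single i 1, k) - Complex.I * k i * W₀.coeff (0, k)) := by
        have hW₀i : W₀.coeff (Pi.single i 1, k) = 0 := by
          rw [hW₀, coeff_solveDeg, hdeg]
          simp
        rw [hW, AddMonoidAlgebra.coeff_add, Finsupp.add_apply, hW₀i, hW₁, coeff_solveDeg ω 1,
          if_pos hdeg, AddMonoidAlgebra.coeff_sub, Finsupp.sub_apply, coeff_sum_pVar_mul_single,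
          partialDeriv_inl, coeff_dq, zero_add]
      have hW0 : W.coeff (0, k) = W₀.coeff (0, k) := by
        rw [hW, AddMonoidAlgebra.coeff_add, Finsupp.add_apply, hW₁, coeff_solveDeg ω 1]
        simp
      rw [coeff_sum_pVar_mul_single, hw i]
      simp only [hw _ (Pi.single i 1) k, hsingle, false_and, if_false, neg_zero, zero_sub, hWi, hW0]
      by_cases hk : k = 0
      · subst hk
        simp [hξ]
      · rw [hsolve k hk]
        simp only [hk, and_false, if_false]
        ring

/-! ### The generating field and the normal form -/

lemma Diophantine.sum_mul_ne_zero {ω : Fin ν → ℝ} (hω : Diophantine ω) (k : Fin ν → ℤ)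
    (hk : k ≠ 0) : ∑ j, (k j : ℝ) * ω j ≠ 0 := by
  obtain ⟨γ, τ, hγ, -, h⟩ := hω
  obtain ⟨i, hi⟩ := Function.ne_iff.1 hk
  have hpos : 0 < ∑ j, |(k j : ℝ)| :=
    Finset.sum_pos' (fun _ _ => abs_nonneg _) ⟨i, Finset.mem_univ i, by simpa using hi⟩
  exact abs_pos.1 ((div_pos hγ (Real.rpow_pos_of_pos hpos τ)).trans_le (h k hk))

/-- The sequence `a, u_0, u_1, …`. -/
def prepend {X : Type*} (a : X) (u : ℕ → X) : ℕ → X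
  | 0 => a
  | n + 1 => u n

lemma prepend_congr {X : Type*} (a : X) {u u' : ℕ → X} {n m : ℕ} (h : ∀ i < n, u i = u' i)
    (hm : m ≤ n) : prepend a u m = prepend a u' m := by
  rcases m with _ | m
  · rfl
  · exact h m hm

lemma isHamiltonianField_zero : IsHamiltonianField (0 : Fin ν ⊕ Fin ν → Obs ν) := by
  constructor <;> intros <;> simp [dp, dq]

/-- There are a Hamiltonian field `v` and series `N` and `g`, to become the pullbacks by the flow of
`v` of `ω · p + p² / 2 + ε f` and of `f`, for which all coefficients of `N` of positive order are
constants plus `O(p²)`. The coefficient `v_n` enters that of order `n + 1` of the equation for `N`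
only through the derivative of `ω · p + p² / 2` along `v_n`, so that it is determined by a
homological equation with data of lower order. -/
lemma exists_field_normalizing {ω : Fin ν → ℝ}
    (hω : ∀ k : Fin ν → ℤ, k ≠ 0 → ∑ j, (k j : ℝ) * ω j ≠ 0) {f : Obs ν} (hf : f.IsReal) :
    ∃ (v : Fin ν ⊕ Fin ν → FObs ν) (N g : FObs ν), (∀ a, (v a).IsReal) ∧
      (∀ n, IsHamiltonianField fun a => PowerSeries.coeff n (v a)) ∧
      transport v g = 0 ∧ PowerSeries.coeff 0 g = f ∧
      transport v N = g ∧ PowerSeries.coeff 0 N = integrable ω ∧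
      N.IsReal ∧ ∀ n, IsConstAddOSq (PowerSeries.coeff (n + 1) N) := by
  -- Fields for data that are not real are set to `0`, so that the reality of `v` can be stated
  -- before that of the data, which depend on `v`.
  have hex : ∀ Z : Obs ν, ∃ w : Fin ν ⊕ Fin ν → Obs ν, IsHamiltonianField w ∧
      (∀ a, (w a).IsReal) ∧ (Z.IsReal → IsConstAddOSq (dirDeriv w (integrable ω) + Z)) := by
    intro Z
    by_cases hZ : Z.IsReal
    · obtain ⟨w, h1, h2, h3⟩ := exists_field_homological hω hZ
      exact ⟨w, h1, h2, fun _ => h3⟩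
    · exact ⟨0, isHamiltonianField_zero, fun _ => mem_realObs.1 (zero_mem _),
        fun h => absurd h hZ⟩
  choose field hHam hReal hNormal using hex
  -- The terms of index `n` of the recursion are `v_n`, `N_{n+1}` and `g_{n+1}`.
  let data : ℕ → (ℕ → (Fin ν ⊕ Fin ν → Obs ν) × Obs ν × Obs ν) → Obs ν := fun n x =>
    ∑ s ∈ Finset.range n, dirDeriv (x s).1 (prepend (integrable ω) (fun i => (x i).2.1) (n - s)) +
      prepend f (fun i => (x i).2.2) n
  let source : ℕ → (ℕ → (Fin ν ⊕ Fin ν → Obs ν) × Obs ν × Obs ν) → Obs ν := fun n x =>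
    ∑ s ∈ Finset.range n, dirDeriv (x s).1 (prepend f (fun i => (x i).2.2) (n - s))
  have hdata : ∀ n x y, (∀ m < n, x m = y m) → data n x = data n y := by
    intro n x y h
    simp only [data]
    congr 1
    · refine Finset.sum_congr rfl fun s hs => ?_
      rw [h s (Finset.mem_range.1 hs),
        prepend_congr _ (fun i hi => congrArg (fun z => z.2.1) (h i hi)) (n.sub_le s)]
    · exact prepend_congr _ (fun i hi => congrArg (fun z => z.2.2) (h i hi)) le_rfl
  have hsource : ∀ n x y, (∀ m < n, x m = y m) → source n x = source n y := by
    intro n x y h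
    refine Finset.sum_congr rfl fun s hs => ?_
    rw [h s (Finset.mem_range.1 hs),
      prepend_congr _ (fun i hi => congrArg (fun z => z.2.2) (h i hi)) (n.sub_le s)]
  obtain ⟨x, hx⟩ := exists_seq_of_recursion
    (fun n x => (field (data n x),
      ((n : ℂ) + 1)⁻¹ • (dirDeriv (field (data n x)) (integrable ω) + data n x),
      ((n : ℂ) + 1)⁻¹ • (dirDeriv (field (data n x)) f + source n x)))
    (fun n x y h => by simp only [hdata n x y h, hsource n x y h])
  have hx1 : ∀ n, (x n).1 = field (data n x) := fun n => by rw [hx n]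
  let v : Fin ν ⊕ Fin ν → FObs ν := fun a => PowerSeries.mk fun n => (x n).1 a
  let N : FObs ν := PowerSeries.mk (prepend (integrable ω) fun i => (x i).2.1)
  let g : FObs ν := PowerSeries.mk (prepend f fun i => (x i).2.2)
  have hvn : ∀ n, (fun a => PowerSeries.coeff n (v a)) = (x n).1 := fun n => by
    funext a
    exact PowerSeries.coeff_mk _ _
  have hv : ∀ a, (v a).IsReal := fun a n => by
    rw [PowerSeries.coeff_mk, hx1]
    exact hReal _ a
  have hg : transport v g = 0 := by
    rw [transport_eq_iff]
    intro n
    simp only [hvn, g, PowerSeries.coeff_mk, map_zero, add_zero]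
    rw [Finset.Nat.sum_antidiagonal_eq_sum_range_succ_mk, Finset.sum_range_succ, Nat.sub_self,
      hx1 n, add_comm (Finset.sum _ _)]
    change (x n).2.2 = _
    rw [hx n]
    rfl
  have hN : transport v N = g := by
    rw [transport_eq_iff]
    intro n
    simp only [hvn, g, N, PowerSeries.coeff_mk]
    rw [Finset.Nat.sum_antidiagonal_eq_sum_range_succ_mk, Finset.sum_range_succ, Nat.sub_self,
      hx1 n, add_comm (Finset.sum _ _), add_assoc]
    change (x n).2.1 = _
    rw [hx n]
    rfl
  have hg0 : PowerSeries.coeff 0 g = f := PowerSeries.coeff_mk _ _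
  have hN0 : PowerSeries.coeff 0 N = integrable ω := PowerSeries.coeff_mk _ _
  have hzero : FObs.IsReal (0 : FObs ν) := fun _ => mem_realObs.1 (zero_mem _)
  have hgreal : g.IsReal := isReal_of_transport_eq hv hzero (by rwa [hg0]) hg
  have hNreal : N.IsReal :=
    isReal_of_transport_eq hv hgreal (by rw [hN0]; exact isReal_integrable ω) hN
  have hdreal : ∀ n, (data n x).IsReal := by
    intro n
    refine mem_realObs.1 (add_mem (sum_mem fun s _ => mem_realObs.2 ?_) (mem_realObs.2 ?_))
    · refine isReal_dirDeriv (fun a => ?_) ?_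
      · rw [hx1]
        exact hReal _ a
      · simpa only [N, PowerSeries.coeff_mk] using hNreal (n - s)
    · simpa only [g, PowerSeries.coeff_mk] using hgreal n
  refine ⟨v, N, g, hv, fun n => ?_, hg, hg0, hN, hN0, hNreal, fun n α k hα hne => ?_⟩
  · rw [hvn, hx1]
    exact hHam _
  · rw [PowerSeries.coeff_mk]
    change (x n).2.1.coeff (α, k) = 0
    rw [hx n]
    change ((n : ℂ) + 1)⁻¹ • (dirDeriv _ _ + data n x).coeff (α, k) = 0
    rw [hNormal _ (hdreal n) α k hα hne, smul_zero]

lemma coeff_omegaDot (ω : Fin ν → ℝ) (α : Fin ν → ℕ) (k : Fin ν → ℤ) :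
    (omegaDot ω).coeff (α, k) = ∑ j, if α = Pi.single j 1 ∧ k = 0 then (ω j : ℂ) else 0 := by
  rw [omegaDot, AddMonoidAlgebra.coeff_sum, Finsupp.finsetSum_apply]
  refine Finset.sum_congr rfl fun j _ => ?_
  simp [pVar, Finsupp.single_apply, Prod.ext_iff, eq_comm]

/-- The integrable Hamiltonian is `ω · p + O(p²)`. -/
lemma coeff_integrable (ω : Fin ν → ℝ) (α : Fin ν → ℕ) (k : Fin ν → ℤ) (hα : ∑ j, α j < 2) :
    (integrable ω).coeff (α, k) = (omegaDot ω).coeff (α, k) := by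
  rw [integrable, AddMonoidAlgebra.coeff_add, Finsupp.add_apply, add_eq_left]
  have hj : ∀ j, (pVar j ^ 2 : Obs ν).coeff (α, k) = 0 := by
    intro j
    rw [pVar, AddMonoidAlgebra.single_pow, AddMonoidAlgebra.coeff_single, Finsupp.single_apply,
      if_neg]
    rintro h
    have h' : (2 • Pi.single j 1 : Fin ν → ℕ) = α := congrArg Prod.fst h
    subst h'
    simp [← Finset.mul_sum] at hα
  simp [hj]

end FormalKolmogorov

open FormalKolmogorov in
theorem theorem8p1 (ν : ℕ) (ω : Fin ν → ℝ) (hω : Diophantine ω)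
    (f : Obs ν) (hf : f.IsTrigPoly) (hf_real : f.IsReal) :
    ∃ (Φ : FormalTransformation ν) (c : PowerSeries ℝ) (R : FObs ν),
      Φ.IsCanonical ∧ R.IsReal ∧ R.IsOSq ∧
        Φ.pullback (hamiltonian ω f) =
          constSeries ν c + PowerSeries.C (omegaDot ω) + R := by
  obtain ⟨v, N, g, hv, hHam, hg, hg0, hN, hN0, hNreal, hNormal⟩ :=
    exists_field_normalizing hω.sum_mul_ne_zero hf_real
  obtain ⟨Φ, hΦ⟩ := exists_isFlow hv
  have hsubst : Φ.subst f = g :=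
    eq_of_transport_eq (v := v) ((hΦ.transport_subst f).trans hg.symm)
      ((Φ.coeff_zero_subst f).trans hg0.symm)
  have hpull : Φ.pullback (hamiltonian ω f) = N := by
    change Φ.pullback (PowerSeries.C (integrable ω) + _) = N
    rw [Φ.pullback_C_add_X_mul_C]
    refine eq_of_transport_eq (v := v) ?_ ?_
    · have hX : transport v (PowerSeries.X : FObs ν) = 1 := by
        have h : ∀ a, seriesDeriv (partialDeriv a) (PowerSeries.X : FObs ν) = 0 := fun a => by
          ext1 n
          rw [coeff_seriesDeriv, PowerSeries.coeff_X]
          split_ifs <;> simp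
        simp [transport_apply, h]
      rw [map_add, hΦ.transport_subst, Derivation.leibniz, hΦ.transport_subst, hX, hN, hsubst]
      simp
    · rw [map_add, Φ.coeff_zero_subst, hN0, PowerSeries.coeff_zero_X_mul, add_zero]
  refine ⟨Φ, PowerSeries.mk fun n => ((PowerSeries.coeff n N).coeff (0, 0)).re,
    N - constSeries ν (PowerSeries.mk fun n => ((PowerSeries.coeff n N).coeff (0, 0)).re) -
      PowerSeries.C (omegaDot ω), hΦ.isCanonical hHam, fun n => ?_, fun n α k hα => ?_, ?_⟩
  · rw [map_sub, map_sub]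
    refine mem_realObs.1 (sub_mem (sub_mem (mem_realObs.2 (hNreal n)) (mem_realObs.2 ?_)) ?_)
    · rw [constSeries, PowerSeries.coeff_mk]
      exact isReal_single_zero (Complex.conj_ofReal _)
    · rw [PowerSeries.coeff_C]
      split_ifs
      · exact sum_mem fun j _ => mem_realObs.2 ((isReal_pVar j).smul _)
      · exact zero_mem _
  · have hre : ((((PowerSeries.coeff n N).coeff (0, 0)).re : ℝ) : ℂ) =
        (PowerSeries.coeff n N).coeff (0, 0) :=
      Complex.conj_eq_iff_re.1 (by simpa using (hNreal n 0 0).symm)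
    simp only [map_sub, constSeries, PowerSeries.coeff_mk, hre, AddMonoidAlgebra.coeff_sub,
      Finsupp.sub_apply, AddMonoidAlgebra.coeff_single, Finsupp.single_apply]
    by_cases h : α = 0 ∧ k = 0
    · obtain ⟨rfl, rfl⟩ := h
      rw [if_pos (show (0 : (Fin ν → ℕ) × (Fin ν → ℤ)) = (0, 0) from rfl), sub_self]
      rcases n with _ | n
      · simp [coeff_omegaDot, eq_comm]
      · simp [PowerSeries.coeff_succ_C]
    · have h' : ¬ (0 : (Fin ν → ℕ) × (Fin ν → ℤ)) = (α, k) := fun e =>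
        h ⟨(congrArg Prod.fst e).symm, (congrArg Prod.snd e).symm⟩
      rw [if_neg h', sub_zero]
      rcases n with _ | n
      · rw [hN0, coeff_integrable ω α k hα]
        simp
      · rw [hNormal n α k hα (by tauto), PowerSeries.coeff_succ_C]
        simp
  · rw [hpull]
    ring
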